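/- Let $n\ge 1$ and let $\mathfrak S_n$ be the set of permutations $\pi=\pi_1\pi_2\cdots\pi_n$ of $\{1,\dots,n\}$. The pinnacle set of $\pi$ is $$\operatorname{Pin}\pi=\{\pi_i : 1<i<n,\ \pi_{i-1}<\pi_i>\pi_{i+1}\}.$$ A set $S$ is called admissible if $S=\operatorname{Pin}\pi$ for some $m$ and some $\pi\in\mathfrak S_m$. Write $p_S(n)=\#\{\pi\in\mathfrak S_n : \operatorname{Pin}\pi=S\}$. Let $S=\{s_1<s_2<\dots<s_d\}$ be an admissible set (possibly empty, $d\ge 0$) all of whose elements are at most $n$. Put $s_0=0$, $s_{d+1}=n+1$ and $n_i=s_{i+1}-s_i-1$ for $0\le i\le d$. Let $D$ be the totally ordered set $$D=\{1_l<1_r<2_l<2_r<\dots<d_l<d_r\},$$ where $i_l$ and $i_r$ are said to have rank $i$. For $B\subseteq D$ let $b=|B|$, let $r_j$ be the rank of the $j$-th smallest element of $B$ ($1\le j\le b$), and let $b_i$ be the number of elements of $B$ of rank at least $i$ (so $b_{d+1}=0$). Then, with the convention $0^0=1$, $$p_S(n)=2^{\,n-2d-1}\sum_{B\subseteq D,\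 |B|\le d}(-1)^{b}\,(d-b)!\,\left(\prod_{i=0}^{b-1}\bigl(d+1-i-r_{b-i}\bigr)\right)\left(\prod_{i=0}^{d}\bigl(d+1-i-b_{i+1}\bigr)^{n_i}\right).$$ -/

import Mathlib

namespace Pinnacle

/-- The pinnacle set of `π ∈ 𝔖_n`. The one-line word of `π` has the entries `π j + 1`, `j : Fin n`
(so that its letters are `1, …, n`); a pinnacle is an entry that has a neighbour on both sides and
exceeds both of them. -/
def pinnacleSet {n : ℕ} (π : Equiv.Perm (Fin n)) : Finset ℕ :=
  (Finset.univ.filter fun j : Fin n =>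
    ∃ i k : Fin n, (i : ℕ) + 1 = j ∧ (j : ℕ) + 1 = k ∧ π i < π j ∧ π k < π j).image
      fun j => (π j : ℕ) + 1

/-- `S` is an admissible pinnacle set: it is the pinnacle set of some permutation. -/
def IsAdmissible (S : Finset ℕ) : Prop :=
  ∃ (m : ℕ) (π : Equiv.Perm (Fin m)), pinnacleSet π = S

/-- `p_S(n)`, the number of permutations in `𝔖_n` with pinnacle set `S`. -/
def pinnacleCount (S : Finset ℕ) (n : ℕ) : ℕ :=
  (Finset.univ.filter fun π : Equiv.Perm (Fin n) => pinnacleSet π = S).card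

/-- `s_i` for `0 ≤ i ≤ d + 1`, where `S = {s_1 < … < s_d}`, `s_0 = 0` and `s_{d+1} = n + 1`. -/
def pinnacleValue (n : ℕ) (S : Finset ℕ) (i : ℕ) : ℕ :=
  if i = 0 then 0
  else if h : i - 1 < S.card then S.orderEmbOfFin rfl ⟨i - 1, h⟩
  else n + 1

/-- `n_i = s_{i+1} - s_i - 1`, for `0 ≤ i ≤ d`. -/
def gap (n : ℕ) (S : Finset ℕ) (i : ℕ) : ℕ :=
  pinnacleValue n S (i + 1) - pinnacleValue n S i - 1

/-- The master dale rank set `D = {1_l < 1_r < 2_l < 2_r < … < d_l < d_r}` with its total order.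
The element `(k, false)` is `(k + 1)_l`, and `(k, true)` is `(k + 1)_r`. -/
abbrev DaleRank (d : ℕ) : Type := Fin d ×ₗ Bool

/-- The rank of an element of `D`. -/
def DaleRank.rank {d : ℕ} (x : DaleRank d) : ℕ := ((ofLex x).1 : ℕ) + 1

/-- `r_j`, the rank of the `j`-th smallest element of `B`, for `1 ≤ j ≤ #B`
(and `0` for other `j`). -/
def nthRank {d : ℕ} (B : Finset (DaleRank d)) (j : ℕ) : ℕ :=
  if h : 1 ≤ j ∧ j ≤ B.card then
    DaleRank.rank (B.orderEmbOfFin rfl ⟨j - 1, Nat.sub_one_lt_of_le h.1 h.2⟩)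
  else 0

/-- `b_i`, the number of elements of `B` of rank at least `i`. -/
def numRankGE {d : ℕ} (B : Finset (DaleRank d)) (i : ℕ) : ℕ :=
  (B.filter fun x => i ≤ DaleRank.rank x).card

end Pinnacle

namespace Pinnacle

/-! Call a word on a letter set `V` good if its pinnacles are exactly `S ∩ V`. Splitting a good word
at its largest letter `v` leaves two good words on complementary subsets, both nonempty if `v ∈ S`,
at least one empty if `v ∉ S`. Let `w` be twice the number of good words, corrected to `1` on `∅`.
In terms of subset convolution the splitting reads `w (V ∪ {v}) = 2 w V` for `v ∉ S` and `(w * w - 2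
w + 1) V / 2` for `v ∈ S`, where `1` is the unit of convolution (`wordWeight_insert_of_notMem`,
`wordWeight_insert_of_mem`). Adjoining a point is a derivation (`convPow_succ_insert`), so the
values `F_v(m)` of the `m`-th convolution power of `w` on `{1, …, v}` obey a recursion in `v` alone:
multiply by `2m` at a non-pinnacle, and apply `m/2` times a second central difference in `m` at a
pinnacle. Then `p_S(n) = F_n(1) / 2`. Each second difference `F(m+1) - 2F(m) + F(m-1)` is a signed
sum over subsets of a two-element set, with argument `m + 1 - e` and sign `(-1)^e` for a subset of
size `e`. Expanding all `d` of them gives one product per `B ⊆ D` (`gapCount_eq_sum`). At `m = 1`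
the factors follow a lattice path with steps in `{-1, 0, 1}`: `prod_height_eq` turns the factors
`m/2` into the factorial and rank product when `|B| ≤ d`, and `exists_add_eq_succ` supplies a zero
factor when `|B| > d`. -/

/-! ### Subset convolution and its powers. -/

/-- The subset convolution of two set functions. -/
def subsetConv (f g : Finset ℕ → ℚ) (V : Finset ℕ) : ℚ :=
  ∑ A ∈ V.powerset, f A * g (V \ A)

theorem subsetConv_comm (f g : Finset ℕ → ℚ) : subsetConv f g = subsetConv g f := by
  funext V
  unfold subsetConv
  refine Finset.sum_nbij' (V \ ·) (V \ ·) ?_ ?_ ?_ ?_ ?_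
  · intro A _; simp
  · intro A _; simp
  · intro A hA; simpa using Finset.mem_powerset.1 hA
  · intro A hA; simpa using Finset.mem_powerset.1 hA
  · intro A hA
    simp only [Finset.sdiff_sdiff_eq_self (Finset.mem_powerset.1 hA)]
    ring

theorem subsetConv_left_comm (f g h : Finset ℕ → ℚ) :
    subsetConv f (subsetConv g h) = subsetConv g (subsetConv f h) := by
  funext V
  unfold subsetConv
  simp only [Finset.mul_sum]
  rw [Finset.sum_comm' (t' := V.powerset) (s' := fun C => (V \ C).powerset)]
  · refine Finset.sum_congr rfl fun C _ => Finset.sum_congr rfl fun A _ => ?_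
    rw [sdiff_right_comm]
    ring
  · intro A C
    simp only [Finset.mem_powerset, Finset.subset_sdiff]
    constructor
    · rintro ⟨h1, h2, h3⟩; exact ⟨⟨h1, h3.symm⟩, h2⟩
    · rintro ⟨⟨h1, h3⟩, h2⟩; exact ⟨h1, h2, h3.symm⟩

theorem subsetConv_assoc (f g h : Finset ℕ → ℚ) :
    subsetConv (subsetConv f g) h = subsetConv f (subsetConv g h) := by
  rw [subsetConv_comm, subsetConv_left_comm, subsetConv_comm h g]

theorem subsetConv_congr_left {f f' g : Finset ℕ → ℚ} {V : Finset ℕ}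
    (h : ∀ A ⊆ V, f A = f' A) : subsetConv f g V = subsetConv f' g V :=
  Finset.sum_congr rfl fun A hA => by rw [h A (Finset.mem_powerset.1 hA)]

theorem subsetConv_congr_right {f g g' : Finset ℕ → ℚ} {V : Finset ℕ}
    (h : ∀ A ⊆ V, g A = g' A) : subsetConv f g V = subsetConv f g' V :=
  Finset.sum_congr rfl fun A _ => by rw [h _ Finset.sdiff_subset]

theorem subsetConv_add_left (f g h : Finset ℕ → ℚ) :
    subsetConv (f + g) h = subsetConv f h + subsetConv g h := by
  funext V
  simp [subsetConv, add_mul, Finset.sum_add_distrib]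

theorem subsetConv_smul_left (a : ℚ) (f g : Finset ℕ → ℚ) :
    subsetConv (a • f) g = a • subsetConv f g := by
  funext V
  simp [subsetConv, mul_assoc, Finset.mul_sum]

theorem subsetConv_smul_right (a : ℚ) (f g : Finset ℕ → ℚ) :
    subsetConv f (a • g) = a • subsetConv f g := by
  rw [subsetConv_comm, subsetConv_smul_left, subsetConv_comm]

/-- The powers of a set function with respect to `subsetConv`. -/
def convPow (f : Finset ℕ → ℚ) : ℕ → Finset ℕ → ℚ
  | 0 => fun V => if V = ∅ then 1 else 0
  | m + 1 => subsetConv f (convPow f m)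

theorem subsetConv_convPow_zero (f g : Finset ℕ → ℚ) : subsetConv (convPow f 0) g = g := by
  funext V
  unfold subsetConv
  rw [Finset.sum_eq_single ∅]
  · simp [convPow]
  · intro A _ hA; simp [convPow, hA]
  · simp

theorem convPow_one (f : Finset ℕ → ℚ) : convPow f 1 = f := by
  change subsetConv f (convPow f 0) = f
  rw [subsetConv_comm, subsetConv_convPow_zero]

theorem convPow_empty {f : Finset ℕ → ℚ} (hf : f ∅ = 1) (m : ℕ) : convPow f m ∅ = 1 := by
  induction m with
  | zero => simp [convPow]
  | succ m ih => simp [convPow, subsetConv, hf, ih]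

theorem subsetConv_insert (f g : Finset ℕ → ℚ) {v : ℕ} {V : Finset ℕ} (hv : v ∉ V) :
    subsetConv f g (insert v V) =
      subsetConv (fun A => f (insert v A)) g V + subsetConv f (fun A => g (insert v A)) V := by
  unfold subsetConv
  rw [Finset.sum_powerset_insert hv, add_comm]
  congr 1
  · refine Finset.sum_congr rfl fun A _ => ?_
    rw [Finset.insert_sdiff_insert, Finset.sdiff_insert_of_notMem hv]
  · refine Finset.sum_congr rfl fun A hA => ?_
    rw [Finset.insert_sdiff_of_notMem _ fun h => hv (Finset.mem_powerset.1 hA h)]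

/-- Adjoining a new point acts on convolution powers as a derivation. -/
theorem convPow_succ_insert (f : Finset ℕ → ℚ) (m : ℕ) {v : ℕ} {V : Finset ℕ} (hv : v ∉ V) :
    convPow f (m + 1) (insert v V) =
      (m + 1) * subsetConv (fun A => f (insert v A)) (convPow f m) V := by
  induction m generalizing V with
  | zero =>
    rw [subsetConv_comm, subsetConv_convPow_zero, convPow_one]
    simp
  | succ m ih =>
    change subsetConv f (convPow f (m + 1)) (insert v V) = _
    rw [subsetConv_insert _ _ hv]
    have h : subsetConv f (fun A => convPow f (m + 1) (insert v A)) V =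
        (m + 1) * subsetConv (fun A => f (insert v A)) (convPow f (m + 1)) V := by
      rw [subsetConv_congr_right
        (g' := ((m : ℚ) + 1) • subsetConv (fun A => f (insert v A)) (convPow f m))
        fun A hA => ih fun h => hv (hA h), subsetConv_smul_right, subsetConv_left_comm]
      rfl
    rw [h]
    push_cast
    ring

/-! ### Pinnacles of words and splitting at the largest letter. -/

/-- The pinnacles of a word. -/
def wordPinnacles : List ℕ → Finset ℕ
  | a :: x :: b :: t => (if a < x ∧ b < x then {x} else ∅) ∪ wordPinnacles (x :: b :: t)
  | _ => ∅

theorem mem_wordPinnacles {x : ℕ} : ∀ {l : List ℕ}, x ∈ wordPinnacles l ↔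
    ∃ (i : ℕ) (h : i + 2 < l.length), l[i] < l[i + 1] ∧ l[i + 2] < l[i + 1] ∧ l[i + 1] = x
  | [] => by simp [wordPinnacles]
  | [a] => by simp [wordPinnacles]
  | [a, b] => by simp [wordPinnacles]
  | a :: y :: b :: t => by
    rw [wordPinnacles, Finset.mem_union, mem_wordPinnacles]
    constructor
    · rintro (h | ⟨i, h, h1⟩)
      · split_ifs at h with hc
        · exact ⟨0, by simp, hc.1, hc.2, (Finset.mem_singleton.1 h).symm⟩
        · simp at h
      · exact ⟨i + 1, by simpa using h, h1⟩
    · rintro ⟨_ | i, h, h1⟩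
      · left
        have hc : a < y ∧ b < y := ⟨h1.1, h1.2.1⟩
        rw [if_pos hc, Finset.mem_singleton]
        exact h1.2.2.symm
      · exact Or.inr ⟨i, by simpa using h, h1⟩

theorem wordPinnacles_subset (l : List ℕ) : wordPinnacles l ⊆ l.toFinset := by
  intro x hx
  obtain ⟨i, h, -, -, rfl⟩ := mem_wordPinnacles.1 hx
  simp

theorem wordPinnacles_cons_of_forall_lt {v : ℕ} {r : List ℕ} (hr : ∀ x ∈ r, x < v) :
    wordPinnacles (v :: r) = wordPinnacles r := by
  match r with
  | [] => rfl
  | [b] => rfl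
  | b :: c :: t =>
    have : ¬ v < b := (hr b (by simp)).le.not_gt
    simp [wordPinnacles, this]

/-- A letter next to `v` is an end of `l` or `r`, hence no pinnacle there, and its larger neighbour
`v` keeps it from becoming one. So `l` and `r` contribute independently, and `v` is a pinnacle
exactly when it has two neighbours. -/
theorem wordPinnacles_append_cons {v : ℕ} {r : List ℕ} (hr : ∀ x ∈ r, x < v) :
    ∀ {l : List ℕ}, (∀ x ∈ l, x < v) →
      wordPinnacles (l ++ v :: r) =
        wordPinnacles l ∪ wordPinnacles r ∪ if l = [] ∨ r = [] then ∅ else {v}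
  | [], _ => by simp [wordPinnacles_cons_of_forall_lt hr, wordPinnacles]
  | [a], hl => by
    match r, hr with
    | [], _ => simp [wordPinnacles]
    | b :: t, hr =>
      have h1 : a < v := hl a (by simp)
      have h2 : b < v := hr b (by simp)
      rw [List.singleton_append, wordPinnacles, wordPinnacles_cons_of_forall_lt hr]
      simp [h1, h2, wordPinnacles, Finset.union_comm]
  | [a, y], hl => by
    have h1 : ¬ v < y := (hl y (by simp)).le.not_gt
    have ih := wordPinnacles_append_cons hr (l := [y]) (by simpa using hl y (by simp))
    simp only [List.cons_append, List.nil_append] at ih ⊢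
    rw [wordPinnacles, ih]
    simp [h1, wordPinnacles]
  | a :: y :: b :: t, hl => by
    have ih := wordPinnacles_append_cons hr (l := y :: b :: t)
      fun x hx => hl x (List.mem_cons_of_mem _ hx)
    simp only [List.cons_append] at ih ⊢
    rw [wordPinnacles, wordPinnacles, ih]
    simp [Finset.union_assoc]

/-- The words using each letter of `V` once, whose pinnacles are the elements of `S` in `V`. -/
def pinWords (S V : Finset ℕ) : Finset (List ℕ) :=
  V.val.lists.toFinset.filter fun l => wordPinnacles l = S ∩ V

theorem mem_pinWords {S V : Finset ℕ} {l : List ℕ} :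
    l ∈ pinWords S V ↔ l.Nodup ∧ l.toFinset = V ∧ wordPinnacles l = S ∩ V := by
  rw [pinWords, Finset.mem_filter, Multiset.mem_toFinset, Multiset.mem_lists_iff,
    Multiset.quot_mk_to_coe, ← and_assoc]
  refine and_congr_left fun _ => ?_
  constructor
  · intro h
    have hd : l.Nodup := by
      rw [← Multiset.coe_nodup, ← h]; exact V.nodup
    refine ⟨hd, ?_⟩
    ext x
    rw [List.mem_toFinset, ← Multiset.mem_coe, ← h, Finset.mem_val]
  · rintro ⟨hd, rfl⟩
    rw [List.toFinset_val, hd.dedup]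

theorem pinWords_empty (S : Finset ℕ) : pinWords S ∅ = {[]} := by
  ext l
  rw [mem_pinWords, Finset.mem_singleton]
  constructor
  · rintro ⟨-, h, -⟩; simpa using h
  · rintro rfl; simp [wordPinnacles]

theorem forall_mem_lt_of_mem_pinWords {S V : Finset ℕ} {v : ℕ} {l : List ℕ}
    (hV : ∀ x ∈ V, x < v) (hl : l ∈ pinWords S V) : ∀ x ∈ l, x < v := fun x hx =>
  hV x <| by rw [← (mem_pinWords.1 hl).2.1]; simpa using hx

theorem append_cons_mem_pinWords {S V : Finset ℕ} {v : ℕ} (hV : ∀ x ∈ V, x < v)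
    {l r : List ℕ} :
    l ++ v :: r ∈ pinWords S (insert v V) ↔
      ∃ A ⊆ V, l ∈ pinWords S A ∧ r ∈ pinWords S (V \ A) ∧
        (v ∈ S ↔ l ≠ [] ∧ r ≠ []) := by
  have hvV : v ∉ V := fun h => lt_irrefl _ (hV v h)
  -- The pinnacles of `l`, those of `r` and `v` itself lie in the disjoint sets `A`, `V \ A` and
  -- `{v}`, so one equality of sets separates into three conditions.
  have key : ∀ A ⊆ V, l.toFinset = A → r.toFinset = V \ A →
      (wordPinnacles (l ++ v :: r) = S ∩ insert v V ↔
        wordPinnacles l = S ∩ A ∧ wordPinnacles r = S ∩ (V \ A) ∧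
          (v ∈ S ↔ l ≠ [] ∧ r ≠ [])) := by
    intro A hA hl hr
    have hl' : ∀ x ∈ l, x < v := fun x hx => hV x (hA (by rw [← hl]; simpa using hx))
    have hr' : ∀ x ∈ r, x < v := fun x hx =>
      hV x (Finset.sdiff_subset (by rw [← hr]; simpa using hx))
    have h1 := hl ▸ wordPinnacles_subset l
    have h2 := hr ▸ wordPinnacles_subset r
    rw [wordPinnacles_append_cons hr' hl', ← not_or]
    have h3 : ∀ x, x ∈ (if l = [] ∨ r = [] then (∅ : Finset ℕ) else {v}) ↔
        ¬ (l = [] ∨ r = []) ∧ x = v := by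
      intro x; split_ifs with h <;> simp [h]
    generalize (if l = [] ∨ r = [] then (∅ : Finset ℕ) else {v}) = E at *
    generalize (l = [] ∨ r = []) = p at *
    simp only [Finset.ext_iff, Finset.subset_iff, Finset.mem_union, Finset.mem_inter,
      Finset.mem_insert, Finset.mem_sdiff] at *
    constructor
    · intro h
      refine ⟨fun x => ?_, fun x => ?_, ?_⟩
      · have := h x; have := h1 (x := x); have := h2 (x := x); have := hA (x := x)
        have := h3 x
        grind
      · have := h x; have := h1 (x := x); have := h2 (x := x); have := hA (x := x)
        have := h3 x
        grind
      · have := h v; have := h1 (x := v); have := h2 (x := v); have := hA (x := v)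
        have := h3 v
        grind
    · rintro ⟨ha, hb, hc⟩ x
      have := ha x; have := hb x; have := hA (x := x); have := h3 x
      grind
  constructor
  · intro h
    obtain ⟨hd, hs, hp⟩ := mem_pinWords.1 h
    have hd' := List.nodup_append'.1 hd
    obtain ⟨hdl, hdr, hdis⟩ := hd'
    rw [List.nodup_cons] at hdr
    have hvl : v ∉ l := fun hl => hdis hl (by simp)
    have hs' : l.toFinset ∪ r.toFinset = V := by
      ext x
      have := Finset.ext_iff.1 hs x
      simp only [List.mem_toFinset, List.mem_append, List.mem_cons, Finset.mem_insert,
        Finset.mem_union] at this ⊢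
      grind
    have hA : l.toFinset ⊆ V := hs' ▸ Finset.subset_union_left
    have hr : r.toFinset = V \ l.toFinset := by
      rw [← hs', Finset.union_sdiff_left, Finset.sdiff_eq_self_of_disjoint]
      rw [Finset.disjoint_left]
      intro x hx hx'
      exact hdis (List.mem_toFinset.1 hx') (List.mem_cons_of_mem _ (List.mem_toFinset.1 hx))
    obtain ⟨k1, k2, k3⟩ := (key _ hA rfl hr).1 hp
    exact ⟨_, hA, mem_pinWords.2 ⟨hdl, rfl, k1⟩, mem_pinWords.2 ⟨hdr.2, hr, k2⟩, k3⟩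
  · rintro ⟨A, hA, hl, hr, hv⟩
    obtain ⟨l1, l2, l3⟩ := mem_pinWords.1 hl
    obtain ⟨r1, r2, r3⟩ := mem_pinWords.1 hr
    refine mem_pinWords.2 ⟨?_, ?_, (key A hA l2 r2).2 ⟨l3, r3, hv⟩⟩
    · have hl' := forall_mem_lt_of_mem_pinWords (fun x hx => hV x (hA hx)) hl
      have hr' := forall_mem_lt_of_mem_pinWords
        (fun x hx => hV x (Finset.sdiff_subset hx)) hr
      refine List.nodup_append'.2
        ⟨l1, List.nodup_cons.2 ⟨fun h => lt_irrefl _ (hr' v h), r1⟩, fun x hx hx' => ?_⟩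
      rcases List.mem_cons.1 hx' with rfl | hx'
      · exact lt_irrefl _ (hl' _ hx)
      · have h1 : x ∈ A := by rw [← l2]; simpa using hx
        have h2 : x ∈ V \ A := by rw [← r2]; simpa using hx'
        exact (Finset.mem_sdiff.1 h2).2 h1
    · rw [List.toFinset_append, List.toFinset_cons, l2, r2, Finset.union_insert,
        Finset.union_sdiff_of_subset hA]

theorem eq_nil_iff_of_mem_pinWords {S V : Finset ℕ} {l : List ℕ} (hl : l ∈ pinWords S V) :
    l = [] ↔ V = ∅ := by
  rw [← (mem_pinWords.1 hl).2.1, List.toFinset_eq_empty_iff]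

theorem card_pinWords_insert (S : Finset ℕ) {V : Finset ℕ} {v : ℕ} (hV : ∀ x ∈ V, x < v) :
    (pinWords S (insert v V)).card = ∑ A ∈ V.powerset,
      if v ∈ S ↔ A ≠ ∅ ∧ V \ A ≠ ∅ then (pinWords S A).card * (pinWords S (V \ A)).card
      else 0 := by
  rw [← Finset.sum_filter]
  simp only [← Finset.card_product]
  rw [← Finset.card_sigma]
  symm
  refine Finset.card_bij (fun x _ => x.2.1 ++ v :: x.2.2) ?_ ?_ ?_
  · rintro ⟨A, l, r⟩ h
    simp only [Finset.mem_sigma, Finset.mem_filter, Finset.mem_powerset,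
      Finset.mem_product] at h
    obtain ⟨⟨hA, hv⟩, hl, hr⟩ := h
    refine (append_cons_mem_pinWords hV).2 ⟨A, hA, hl, hr, ?_⟩
    rw [hv, ne_eq, ne_eq, ne_eq, ne_eq, eq_nil_iff_of_mem_pinWords hl,
      eq_nil_iff_of_mem_pinWords hr]
  · rintro ⟨A, l, r⟩ h ⟨A', l', r'⟩ h' heq
    simp only [Finset.mem_sigma, Finset.mem_filter, Finset.mem_powerset,
      Finset.mem_product] at h h'
    obtain ⟨⟨hA, -⟩, hl, hr⟩ := h
    obtain ⟨⟨hA', -⟩, hl', hr'⟩ := h'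
    have hlt := forall_mem_lt_of_mem_pinWords (fun x hx => hV x (hA hx)) hl
    have hlt' := forall_mem_lt_of_mem_pinWords (fun x hx => hV x (hA' hx)) hl'
    have hrt := forall_mem_lt_of_mem_pinWords (fun x hx => hV x (Finset.sdiff_subset hx)) hr
    have hrt' := forall_mem_lt_of_mem_pinWords (fun x hx => hV x (Finset.sdiff_subset hx)) hr'
    have := (List.append_cons_inj_of_notMem (fun h => lt_irrefl _ (hlt _ h))
      (fun h => lt_irrefl _ (hrt _ h))).1 heq
    obtain ⟨rfl, -, rfl⟩ := this
    obtain rfl : A = A' := by rw [← (mem_pinWords.1 hl).2.1, (mem_pinWords.1 hl').2.1]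
    rfl
  · intro w hw
    have hvw : v ∈ w := by
      rw [← List.mem_toFinset, (mem_pinWords.1 hw).2.1]; simp
    obtain ⟨l, r, rfl⟩ := List.append_of_mem hvw
    obtain ⟨A, hA, hl, hr, hv⟩ := (append_cons_mem_pinWords hV).1 hw
    refine ⟨⟨A, l, r⟩, ?_, rfl⟩
    simp only [Finset.mem_sigma, Finset.mem_filter, Finset.mem_powerset, Finset.mem_product]
    refine ⟨⟨hA, ?_⟩, hl, hr⟩
    rw [hv, ne_eq, ne_eq, ne_eq, ne_eq, eq_nil_iff_of_mem_pinWords hl,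
      eq_nil_iff_of_mem_pinWords hr]

/-! ### The word weight and the recursion for its convolution powers. -/

/-- Twice the number of words on `V` with pinnacles `S ∩ V` if `V` is nonempty, and `1`
otherwise. -/
def wordWeight (S V : Finset ℕ) : ℚ :=
  2 * (pinWords S V).card - if V = ∅ then 1 else 0

theorem wordWeight_empty (S : Finset ℕ) : wordWeight S ∅ = 1 := by
  norm_num [wordWeight, pinWords_empty]

theorem wordWeight_insert_of_notMem {S V : Finset ℕ} {v : ℕ} (hV : ∀ x ∈ V, x < v)
    (hv : v ∉ S) : wordWeight S (insert v V) = 2 * wordWeight S V := by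
  set c : Finset ℕ → ℚ := fun A => (pinWords S A).card with hc
  set e := convPow c 0 with he
  have h0 : c ∅ = 1 := by simp [hc, pinWords_empty]
  -- A non-pinnacle maximum stands first or last; the last term removes the double count when `V =
  -- ∅`.
  have h1 : c (insert v V) = (subsetConv e c + subsetConv c e - subsetConv e e) V := by
    simp only [hc]
    rw [card_pinWords_insert S hV]
    push_cast
    simp only [Pi.add_apply, Pi.sub_apply, subsetConv, ← Finset.sum_add_distrib,
      ← Finset.sum_sub_distrib]
    refine Finset.sum_congr rfl fun A _ => ?_
    rcases eq_or_ne A ∅ with h | h <;> rcases eq_or_ne (V \ A) ∅ with h' | h' <;>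
      simp [h, h', hv, he, convPow, pinWords_empty]
  rw [subsetConv_comm c e, subsetConv_convPow_zero, subsetConv_convPow_zero] at h1
  have h2 : wordWeight S V = 2 * c V - e V := rfl
  have h3 : wordWeight S (insert v V) = 2 * c (insert v V) := by simp [wordWeight, hc]
  rw [h3, h2, h1]
  simp only [Pi.add_apply, Pi.sub_apply]
  ring

theorem wordWeight_insert_of_mem {S V : Finset ℕ} {v : ℕ} (hV : ∀ x ∈ V, x < v)
    (hv : v ∈ S) : wordWeight S (insert v V) = (subsetConv (wordWeight S) (wordWeight S) V
      - 2 * wordWeight S V + convPow (wordWeight S) 0 V) / 2 := by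
  -- With `q` counting the nonempty words, `w = 2q + e`, so `w * w - 2w + e = 4 q * q`, where `e` is
  -- the unit and `q * q` counts the ways to surround `v` on both sides.
  set c : Finset ℕ → ℚ := fun A => (pinWords S A).card with hc
  set e := convPow (wordWeight S) 0 with he
  set q : Finset ℕ → ℚ := fun A => c A - e A with hq
  have hw : wordWeight S = (2 : ℚ) • q + e := by
    funext A
    simp only [wordWeight, hq, hc, he, convPow, Pi.add_apply, Pi.smul_apply, smul_eq_mul]
    ring
  have h1 : c (insert v V) = subsetConv q q V := by
    simp only [hc]
    rw [card_pinWords_insert S hV]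
    push_cast
    refine Finset.sum_congr rfl fun A _ => ?_
    rcases eq_or_ne A ∅ with h | h <;> rcases eq_or_ne (V \ A) ∅ with h' | h' <;>
      simp [h, h', hv, hq, hc, he, convPow, pinWords_empty]
  have h3 : wordWeight S (insert v V) = 2 * c (insert v V) := by simp [wordWeight, hc]
  have h4 : subsetConv (wordWeight S) (wordWeight S) =
      (4 : ℚ) • subsetConv q q + (4 : ℚ) • q + e := by
    rw [hw, subsetConv_add_left, subsetConv_smul_left, subsetConv_comm q,
      subsetConv_add_left, subsetConv_smul_left, he, subsetConv_convPow_zero,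
      subsetConv_convPow_zero]
    module
  rw [h3, h1, h4, hw]
  simp only [Pi.add_apply, Pi.smul_apply, smul_eq_mul]
  ring

/-- The convolution powers of the word weight over the initial segments `{1, …, v}`. -/
theorem convPow_wordWeight_succ (S : Finset ℕ) (m v : ℕ) :
    convPow (wordWeight S) (m + 1) (Finset.Icc 1 (v + 1)) =
      if v + 1 ∈ S then
        ((m : ℚ) + 1) / 2 * (convPow (wordWeight S) (m + 2) (Finset.Icc 1 v) -
          2 * convPow (wordWeight S) (m + 1) (Finset.Icc 1 v) +
          convPow (wordWeight S) m (Finset.Icc 1 v))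
      else 2 * ((m : ℚ) + 1) * convPow (wordWeight S) (m + 1) (Finset.Icc 1 v) := by
  have hI : Finset.Icc 1 (v + 1) = insert (v + 1) (Finset.Icc 1 v) := by
    ext x; simp only [Finset.mem_Icc, Finset.mem_insert]; lia
  have hlt : ∀ x ∈ Finset.Icc 1 v, x < v + 1 := by
    intro x hx; rw [Finset.mem_Icc] at hx; lia
  rw [hI, convPow_succ_insert _ _ fun h => lt_irrefl _ (hlt _ h)]
  split_ifs with hv
  · rw [subsetConv_congr_left (f' := (1 / 2 : ℚ) • (subsetConv (wordWeight S) (wordWeight S) +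
        ((-2 : ℚ) • wordWeight S + convPow (wordWeight S) 0)))]
    · rw [subsetConv_smul_left, subsetConv_add_left, subsetConv_add_left, subsetConv_smul_left,
        subsetConv_convPow_zero, subsetConv_assoc]
      simp only [Pi.add_apply, Pi.smul_apply, smul_eq_mul, convPow]
      ring
    · intro A hA
      rw [wordWeight_insert_of_mem (fun x hx => hlt x (hA hx)) hv]
      simp only [Pi.add_apply, Pi.smul_apply, smul_eq_mul]
      ring
  · rw [subsetConv_congr_left (f' := (2 : ℚ) • wordWeight S)]
    · rw [subsetConv_smul_left]
      simp only [Pi.smul_apply, smul_eq_mul, convPow]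
      ring
    · intro A hA
      exact wordWeight_insert_of_notMem (fun x hx => hlt x (hA hx)) hv

/-! ### Permutations as words on `{1, …, n}`. -/

theorem mem_pinnacleSet {n : ℕ} {π : Equiv.Perm (Fin n)} {x : ℕ} :
    x ∈ pinnacleSet π ↔ x ∈ wordPinnacles (List.ofFn fun j => (π j : ℕ) + 1) := by
  rw [mem_wordPinnacles]
  simp only [pinnacleSet, Finset.mem_image, Finset.mem_filter, Finset.mem_univ, true_and,
    List.length_ofFn, List.getElem_ofFn, Fin.lt_def, Nat.add_lt_add_iff_right]
  constructor
  · rintro ⟨⟨j, hj⟩, ⟨⟨i, hi⟩, ⟨k, hk⟩, hij, hjk, h1, h2⟩, rfl⟩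
    simp only at hij hjk
    subst hij hjk
    exact ⟨i, hk, h1, h2, rfl⟩
  · rintro ⟨i, hi, h1, h2, rfl⟩
    exact ⟨⟨i + 1, by lia⟩, ⟨⟨i, by lia⟩, ⟨i + 2, hi⟩, rfl, rfl, h1, h2⟩, rfl⟩

theorem pinnacleSet_eq_wordPinnacles {n : ℕ} (π : Equiv.Perm (Fin n)) :
    pinnacleSet π = wordPinnacles (List.ofFn fun j => (π j : ℕ) + 1) :=
  Finset.ext fun _ => mem_pinnacleSet

theorem IsAdmissible.two_le {S : Finset ℕ} (hS : IsAdmissible S) {s : ℕ} (hs : s ∈ S) :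
    2 ≤ s := by
  obtain ⟨m, π, rfl⟩ := hS
  simp only [pinnacleSet, Finset.mem_image, Finset.mem_filter, Finset.mem_univ, true_and] at hs
  obtain ⟨j, ⟨i, k, -, -, h, -⟩, rfl⟩ := hs
  rw [Fin.lt_def] at h
  lia

theorem pinnacleCount_eq_card_pinWords {S : Finset ℕ} {n : ℕ} (hS : S ⊆ Finset.Icc 1 n) :
    pinnacleCount S n = (pinWords S (Finset.Icc 1 n)).card := by
  refine Finset.card_bij (fun π _ => List.ofFn fun j => (π j : ℕ) + 1) ?_ ?_ ?_
  · intro π hπ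
    have h := (Finset.mem_filter.1 hπ).2
    refine mem_pinWords.2 ⟨?_, ?_, ?_⟩
    · refine List.nodup_ofFn.2 fun i j hij => π.injective (Fin.ext ?_)
      simpa using hij
    · ext x
      simp only [List.mem_toFinset, List.mem_ofFn, Finset.mem_Icc]
      constructor
      · rintro ⟨j, rfl⟩; have := (π j).2; lia
      · rintro ⟨h1, h2⟩
        refine ⟨π.symm ⟨x - 1, by lia⟩, ?_⟩
        simp; lia
    · rw [← pinnacleSet_eq_wordPinnacles, h, Finset.inter_eq_left.2 hS]
  · intro π _ σ _ h
    refine Equiv.ext fun j => Fin.ext ?_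
    have := congrFun (List.ofFn_injective h) j
    simpa using this
  · intro l hl
    obtain ⟨hd, hs, hp⟩ := mem_pinWords.1 hl
    have hlen : l.length = n := by
      rw [← List.toFinset_card_of_nodup hd, hs]; simp
    subst hlen
    have hr : ∀ j : Fin l.length, 1 ≤ l[j] ∧ l[j] ≤ l.length := fun j => by
      rw [← Finset.mem_Icc, ← hs]; simp
    let f : Fin l.length → Fin l.length := fun j => ⟨l[j] - 1, by have := hr j; lia⟩
    have hf : Function.Injective f := by
      intro i j hij
      have h1 : l[i] - 1 = l[j] - 1 := congrArg Fin.val hij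
      have h2 : l[i] = l[j] := by have := hr i; have := hr j; lia
      exact Fin.ext ((hd.getElem_inj_iff).1 h2)
    let π : Equiv.Perm (Fin l.length) := Equiv.ofBijective f (Finite.injective_iff_bijective.1 hf)
    have hπ : (List.ofFn fun j => (π j : ℕ) + 1) = l := by
      have : (fun j => (π j : ℕ) + 1) = l.get := by
        funext j
        have := hr j
        change l[j] - 1 + 1 = l[j]
        lia
      rw [this, List.ofFn_get]
    refine ⟨π, ?_, hπ⟩
    rw [Finset.mem_filter]
    refine ⟨Finset.mem_univ _, ?_⟩
    rw [pinnacleSet_eq_wordPinnacles, hπ, hp, Finset.inter_eq_left.2 hS]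

/-! ### The recursion extended to rational `m`. -/

/-- The polynomial functions counting `m`-block arrangements of `{1, …, v}`. -/
def blockCount (S : Finset ℕ) : ℕ → ℚ → ℚ
  | 0, _ => 1
  | v + 1, m =>
    if v + 1 ∈ S then
      m / 2 * (blockCount S v (m + 1) - 2 * blockCount S v m + blockCount S v (m - 1))
    else 2 * m * blockCount S v m

theorem convPow_wordWeight (S : Finset ℕ) (v m : ℕ) :
    convPow (wordWeight S) m (Finset.Icc 1 v) = blockCount S v m := by
  induction v generalizing m with
  | zero => simpa [blockCount] using convPow_empty (wordWeight_empty S) m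
  | succ v ih =>
    cases m with
    -- Both sides vanish: the zeroth power is supported on `∅`, and `blockCount` carries the factor
    -- `m`.
    | zero => simp [blockCount, convPow]
    | succ m =>
      rw [convPow_wordWeight_succ, ih, ih, ih, blockCount]
      push_cast
      rw [show (m : ℚ) + 1 - 1 = m by ring, show (m : ℚ) + 2 = m + 1 + 1 by ring]

theorem pinnacleCount_eq_blockCount {S : Finset ℕ} {n : ℕ} (hn : 1 ≤ n)
    (hS : S ⊆ Finset.Icc 1 n) : (pinnacleCount S n : ℚ) = blockCount S n 1 / 2 := by
  have h := convPow_wordWeight S n 1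
  have hne : Finset.Icc 1 n ≠ ∅ := by
    rw [← Finset.nonempty_iff_ne_empty]; exact Finset.nonempty_Icc.2 hn
  rw [convPow_one, wordWeight, if_neg hne, ← pinnacleCount_eq_card_pinWords hS] at h
  rw [← Nat.cast_one, ← h]
  ring

/-! ### Gaps between consecutive pinnacle values. -/

theorem pinnacleValue_succ {n : ℕ} {S : Finset ℕ} {i : ℕ} (hi : i < S.card) :
    pinnacleValue n S (i + 1) = S.orderEmbOfFin rfl ⟨i, hi⟩ := by
  simp [pinnacleValue, hi]

theorem pinnacleValue_card_succ (n : ℕ) (S : Finset ℕ) :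
    pinnacleValue n S (S.card + 1) = n + 1 := by
  simp [pinnacleValue]

theorem pinnacleValue_succ_mem {n : ℕ} {S : Finset ℕ} {i : ℕ} (hi : i < S.card) :
    pinnacleValue n S (i + 1) ∈ S := by
  rw [pinnacleValue_succ hi]; exact S.orderEmbOfFin_mem rfl _

theorem pinnacleValue_lt_succ {n : ℕ} {S : Finset ℕ} (hS : S ⊆ Finset.Icc 1 n) {i : ℕ}
    (hi : i ≤ S.card) : pinnacleValue n S i < pinnacleValue n S (i + 1) := by
  have hmem : ∀ j < S.card, 1 ≤ pinnacleValue n S (j + 1) ∧ pinnacleValue n S (j + 1) ≤ n :=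
    fun j hj => Finset.mem_Icc.1 (hS (pinnacleValue_succ_mem hj))
  rcases hi.lt_or_eq with h | rfl
  · cases i with
    | zero => exact (hmem 0 h).1
    | succ i =>
      rw [pinnacleValue_succ h, pinnacleValue_succ (by lia : i < S.card)]
      exact (S.orderEmbOfFin rfl).lt_iff_lt.2 (by simp)
  · rw [pinnacleValue_card_succ]
    cases hc : S.card with
    | zero => simp [pinnacleValue]
    | succ i => exact Nat.lt_succ_of_le (hmem i (by lia)).2

theorem notMem_of_pinnacleValue_lt {n : ℕ} {S : Finset ℕ} {i v : ℕ}
    (h1 : pinnacleValue n S i < v) (h2 : v < pinnacleValue n S (i + 1)) : v ∉ S := by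
  intro hv
  rw [← Finset.mem_coe, ← S.range_orderEmbOfFin rfl] at hv
  obtain ⟨j, rfl⟩ := hv
  have hij : i ≤ j := by
    cases i with
    | zero => simp
    | succ i =>
      by_cases hi : i < S.card
      · rw [pinnacleValue_succ hi, OrderEmbedding.lt_iff_lt, Fin.lt_def] at h1
        exact h1
      -- Past the last element both bounds take the default value `n + 1`, so no `v` lies strictly
      -- between them.
      · simp only [pinnacleValue, Nat.add_eq_zero_iff, one_ne_zero, and_false, if_false,
          add_tsub_cancel_right, hi, dif_neg, not_false_eq_true] at h1 h2
        rw [dif_neg (by lia)] at h2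
        lia
  rw [pinnacleValue_succ (lt_of_le_of_lt hij j.2), OrderEmbedding.lt_iff_lt, Fin.lt_def] at h2
  exact absurd h2 hij.not_gt

theorem sum_gap_add {n : ℕ} {S : Finset ℕ} (hS : S ⊆ Finset.Icc 1 n) {k : ℕ}
    (hk : k ≤ S.card + 1) : ∑ i ∈ Finset.range k, gap n S i + k = pinnacleValue n S k := by
  induction k with
  | zero => simp [pinnacleValue]
  | succ k ih =>
    have h := ih (by lia)
    have h' := pinnacleValue_lt_succ hS (i := k) (by lia)
    rw [Finset.sum_range_succ, gap]
    lia

theorem sum_gap {n : ℕ} {S : Finset ℕ} (hS : S ⊆ Finset.Icc 1 n) :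
    ∑ i ∈ Finset.range (S.card + 1), gap n S i + S.card = n := by
  have := sum_gap_add hS le_rfl
  rw [pinnacleValue_card_succ] at this
  lia

/-- The letter `1` is never a pinnacle. This makes the exponent of the `i = 0` gap factor positive,
which is needed to discard the sets `B` with more than `d` elements. -/
theorem IsAdmissible.one_le_gap_zero {n : ℕ} {S : Finset ℕ} (hS : IsAdmissible S) (hn : 1 ≤ n) :
    1 ≤ gap n S 0 := by
  have h0 : pinnacleValue n S 0 = 0 := rfl
  rw [gap, h0]
  rcases S.card.eq_zero_or_pos with h | h
  · have := pinnacleValue_card_succ n S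
    rw [h] at this
    lia
  · have := hS.two_le (pinnacleValue_succ_mem (n := n) h)
    lia

/-! ### The recursion with runs of non-pinnacles collapsed. -/

/-- `blockCount` for a set of pinnacle values with gaps `g 0, …, g i` between them, evaluated
just before the next pinnacle value. -/
def gapCount (g : ℕ → ℕ) : ℕ → ℚ → ℚ
  | 0, m => (2 * m) ^ g 0
  | i + 1, m => (2 * m) ^ g (i + 1) *
      (m / 2 * (gapCount g i (m + 1) - 2 * gapCount g i m + gapCount g i (m - 1)))

theorem blockCount_add {S : Finset ℕ} {a g : ℕ} (h : ∀ v, a < v → v ≤ a + g → v ∉ S) (m : ℚ) :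
    blockCount S (a + g) m = (2 * m) ^ g * blockCount S a m := by
  induction g with
  | zero => simp
  | succ g ih =>
    rw [← add_assoc, blockCount, if_neg (h _ (by lia) (by lia)),
      ih fun v h1 h2 => h v h1 (by lia), pow_succ]
    ring

theorem blockCount_pinnacleValue {n : ℕ} {S : Finset ℕ} (hS : S ⊆ Finset.Icc 1 n) {i : ℕ}
    (hi : i ≤ S.card) (m : ℚ) :
    blockCount S (pinnacleValue n S (i + 1) - 1) m = gapCount (gap n S) i m := by
  have key : ∀ i ≤ S.card, ∀ m : ℚ, blockCount S (pinnacleValue n S (i + 1) - 1) m =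
      (2 * m) ^ gap n S i * blockCount S (pinnacleValue n S i) m := by
    intro i hi m
    have h := pinnacleValue_lt_succ hS hi
    have h' : pinnacleValue n S (i + 1) - 1 = pinnacleValue n S i + gap n S i := by
      rw [gap]; lia
    rw [h', blockCount_add]
    intro v h1 h2
    exact notMem_of_pinnacleValue_lt h1 (by lia)
  induction i generalizing m with
  | zero =>
    rw [key 0 hi]
    simp [pinnacleValue, blockCount, gapCount]
  | succ i ih =>
    have h := pinnacleValue_lt_succ hS (i := i) (by lia)
    have hm : pinnacleValue n S (i + 1) ∈ S := pinnacleValue_succ_mem hi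
    rw [key _ hi, gapCount, ← ih (by lia), ← ih (by lia), ← ih (by lia)]
    obtain ⟨a, ha⟩ : ∃ a, pinnacleValue n S (i + 1) = a + 1 :=
      ⟨pinnacleValue n S (i + 1) - 1, by lia⟩
    rw [ha] at hm ⊢
    rw [blockCount, if_pos hm, add_tsub_cancel_right]

theorem pinnacleCount_eq_gapCount {n : ℕ} {S : Finset ℕ} (hn : 1 ≤ n)
    (hS : S ⊆ Finset.Icc 1 n) :
    (pinnacleCount S n : ℚ) = gapCount (gap n S) S.card 1 / 2 := by
  rw [pinnacleCount_eq_blockCount hn hS, ← blockCount_pinnacleValue hS le_rfl,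
    pinnacleValue_card_succ, add_tsub_cancel_right]

/-! ### Expansion of the second differences over subsets. -/

/-- The number of elements of `B` whose first coordinate is at least `i`. -/
def numFstGE (B : Finset (ℕ × Bool)) (i : ℕ) : ℕ :=
  (B.filter fun x => i ≤ x.1).card

/-- The summand of the expansion of `gapCount` that is indexed by `B`. -/
def gapTerm (g : ℕ → ℕ) (d : ℕ) (B : Finset (ℕ × Bool)) (m : ℚ) : ℚ :=
  (-1) ^ B.card * (∏ i ∈ Finset.range d, (m + d - (i + 1) - numFstGE B (i + 1)) / 2) *
    ∏ i ∈ Finset.range (d + 1), (2 * (m + d - i - numFstGE B i)) ^ g i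

/-- Here `e` is the number of elements that `B'` has at the new top level `d`. Unfolding that level
shifts the argument from `m` to `m + 1 - e`; after unfolding all levels down to `i`, it is `m + d -
i - numFstGE B i`, which explains the factors of `gapTerm`. -/
theorem gapTerm_succ {g : ℕ → ℕ} {d e : ℕ} {B B' : Finset (ℕ × Bool)} (hc : B'.card = B.card + e)
    (hB : ∀ i ≤ d, numFstGE B' i = numFstGE B i + e) (hd : numFstGE B' (d + 1) = 0) (m : ℚ) :
    gapTerm g (d + 1) B' m =
      (2 * m) ^ g (d + 1) * (m / 2 * ((-1) ^ e * gapTerm g d B (m + 1 - e))) := by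
  have h1 : ∏ i ∈ Finset.range d,
      (m + ((d + 1 : ℕ) : ℚ) - (i + 1) - numFstGE B' (i + 1)) / 2 =
      ∏ i ∈ Finset.range d, (m + 1 - e + d - (i + 1) - numFstGE B (i + 1)) / 2 := by
    refine Finset.prod_congr rfl fun i hi => ?_
    rw [Finset.mem_range] at hi
    rw [hB _ (by lia)]
    push_cast
    ring
  have h2 : ∏ i ∈ Finset.range (d + 1),
      (2 * (m + ((d + 1 : ℕ) : ℚ) - i - numFstGE B' i)) ^ g i =
      ∏ i ∈ Finset.range (d + 1), (2 * (m + 1 - e + d - i - numFstGE B i)) ^ g i := by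
    refine Finset.prod_congr rfl fun i hi => ?_
    rw [Finset.mem_range] at hi
    rw [hB _ (by lia)]
    push_cast
    congr 1
    ring
  rw [gapTerm, Finset.prod_range_succ, Finset.prod_range_succ _ (d + 1), h1, h2, gapTerm, hc, hd]
  push_cast
  rw [show m + ((d : ℚ) + 1) - (d + 1) - 0 = m by ring]
  ring

theorem numFstGE_insert {B : Finset (ℕ × Bool)} {x : ℕ × Bool} (hx : x ∉ B) {i : ℕ}
    (hi : i ≤ x.1) : numFstGE (insert x B) i = numFstGE B i + 1 := by
  rw [numFstGE, Finset.filter_insert, if_pos hi, Finset.card_insert_of_notMem, numFstGE]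
  simp [hx]

theorem numFstGE_eq_zero {B : Finset (ℕ × Bool)} {i : ℕ} (h : ∀ x ∈ B, x.1 < i) :
    numFstGE B i = 0 := by
  rw [numFstGE, Finset.card_eq_zero, Finset.filter_eq_empty_iff]
  exact fun x hx => (h x hx).not_ge

theorem gapCount_eq_sum (g : ℕ → ℕ) (d : ℕ) (m : ℚ) :
    gapCount g d m =
      ∑ B ∈ (Finset.range d ×ˢ (Finset.univ : Finset Bool)).powerset, gapTerm g d B m := by
  induction d generalizing m with
  | zero => simp [gapCount, gapTerm, numFstGE]
  | succ d ih =>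
    have hI : Finset.range (d + 1) ×ˢ (Finset.univ : Finset Bool) =
        insert (d, true) (insert (d, false) (Finset.range d ×ˢ Finset.univ)) := by
      ext ⟨i, x⟩
      cases x <;> simp <;> lia
    rw [hI, Finset.sum_powerset_insert (by simp), Finset.sum_powerset_insert (by simp),
      Finset.sum_powerset_insert (by simp), gapCount, ih, ih, ih]
    simp only [Finset.mul_sum, ← Finset.sum_sub_distrib, ← Finset.sum_add_distrib]
    refine Finset.sum_congr rfl fun B hB => ?_
    have hlt : ∀ x ∈ B, x.1 < d := fun x hx => by
      simpa using Finset.mem_powerset.1 hB hx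
    have hnf : (d, false) ∉ B := fun h => lt_irrefl _ (hlt _ h)
    have hnt : (d, true) ∉ B := fun h => lt_irrefl _ (hlt _ h)
    have hnt' : (d, true) ∉ insert (d, false) B := by simp [hnt]
    have h1 : ∀ x ∈ B, x.1 < d + 1 := fun x hx => (hlt x hx).trans d.lt_succ_self
    -- The four ways to extend `B` at level `d` give the coefficients `1, -1, -1, 1` at `m + 1, m,
    -- m, m - 1`; the two singletons together make the middle coefficient `-2`.
    rw [gapTerm_succ (B := B) (B' := B) (e := 0) rfl (fun i _ => rfl) (numFstGE_eq_zero h1),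
      gapTerm_succ (B := B) (B' := insert (d, false) B) (e := 1)
        (Finset.card_insert_of_notMem hnf) (fun i hi => numFstGE_insert hnf hi)
        (numFstGE_eq_zero (by simpa using h1)),
      gapTerm_succ (B := B) (B' := insert (d, true) B) (e := 1)
        (Finset.card_insert_of_notMem hnt) (fun i hi => numFstGE_insert hnt hi)
        (numFstGE_eq_zero (by simpa using h1)),
      gapTerm_succ (B := B) (B' := insert (d, true) (insert (d, false) B)) (e := 2)
        (by rw [Finset.card_insert_of_notMem hnt', Finset.card_insert_of_notMem hnf])
        (fun i hi => by rw [numFstGE_insert hnt' hi, numFstGE_insert hnf hi])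
        (numFstGE_eq_zero (by simpa using h1))]
    push_cast
    rw [show m + 1 - 0 = m + 1 by ring, show m + 1 - 1 = m by ring,
      show m + 1 - 2 = m - 1 by ring]
    ring

/-! ### Lattice paths: evaluation at `m = 1`. -/

/-- Follow the height `t = d - k - c k` as `k` descends from `d`, where it is `0`, to `0`, where it
is `d - c 0`. Passing from `k + 1` at height `t` to `k` contributes the factor `t + 1` on the left.
If `c` grows by `0`, `1` or `2`, the new rank factors are none, `t + 1`, or `(t + 1) t`, and the
height becomes `t + 1`, `t` or `t - 1`, so the factorial balances each time. -/
theorem prod_height_eq {d : ℕ} {c r : ℕ → ℕ} (hcd : c d = 0)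
    (hc : ∀ k < d, c (k + 1) ≤ c k ∧ c k ≤ c (k + 1) + 2)
    (hr : ∀ k < d, ∀ i, c (k + 1) ≤ i → i < c k → r i = k + 1) (hb : c 0 ≤ d) :
    ∏ i ∈ Finset.range d, ((d : ℚ) - i - c (i + 1)) =
      (d - c 0).factorial * ∏ i ∈ Finset.range (c 0), ((d : ℚ) + 1 - i - r i) := by
  set P : ℕ → ℚ := fun k => ∏ i ∈ Finset.Ico k d, ((d : ℚ) - i - c (i + 1)) with hP
  set Q : ℕ → ℚ := fun s => ∏ i ∈ Finset.range s, ((d : ℚ) + 1 - i - r i) with hQ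
  have hQs : ∀ s, Q (s + 1) = Q s * ((d : ℚ) + 1 - s - r s) := fun s =>
    Finset.prod_range_succ _ _
  have hPs : ∀ k < d, P k = ((d : ℚ) - k - c (k + 1)) * P (k + 1) := fun k hk => by
    simp only [hP]
    rw [← Finset.prod_Ioo_mul_eq_prod_Ico hk, mul_comm]
    rfl
  -- The second alternative records a path that has reached height `-1`: the step down from `0` puts
  -- a zero into `Q`, and the next step puts one into `P`.
  have main : ∀ j k, k + j = d →
      (∃ t : ℕ, d = k + c k + t ∧ P k = t.factorial * Q (c k)) ∨
        (Q (c k) = 0 ∧ (d + 1 = k + c k ∨ P k = 0)) := by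
    intro j
    induction j with
    | zero =>
      intro k hk
      obtain rfl : k = d := hk
      left
      exact ⟨0, by simp [hcd], by simp [hP, hQ, hcd]⟩
    | succ j ih =>
      intro k hk
      have hkd : k < d := by lia
      obtain ⟨hc1, hc2⟩ := hc k hkd
      rcases ih (k + 1) (by lia) with ⟨t, ht, hPt⟩ | ⟨h0, h⟩
      · have htq : (d : ℚ) = k + 1 + c (k + 1) + t := by exact_mod_cast ht
        have hQ1 : c (k + 1) < c k → Q (c (k + 1) + 1) = Q (c (k + 1)) * (t + 1) := by
          intro hlt
          rw [hQs, hr k hkd _ le_rfl hlt, htq]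
          push_cast
          ring
        rw [hPs k hkd, hPt, show (d : ℚ) - k - c (k + 1) = t + 1 by rw [htq]; ring]
        obtain h | h | h : c k = c (k + 1) ∨ c k = c (k + 1) + 1 ∨ c k = c (k + 1) + 2 := by lia
        · refine Or.inl ⟨t + 1, by lia, ?_⟩
          rw [h, Nat.factorial_succ]
          push_cast
          ring
        · refine Or.inl ⟨t, by lia, ?_⟩
          rw [h, hQ1 (by lia)]
          ring
        · have hQ2 : Q (c k) = Q (c (k + 1)) * (t + 1) * t := by
            rw [h, hQs, hQ1 (by lia), hr k hkd (c (k + 1) + 1) (by lia) (by lia), htq]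
            push_cast
            ring
          cases t with
          | zero => exact Or.inr ⟨by rw [hQ2]; simp, Or.inl (by lia)⟩
          | succ t =>
            refine Or.inl ⟨t, by lia, ?_⟩
            rw [hQ2, Nat.factorial_succ]
            push_cast
            ring
      · right
        constructor
        · simp only [hQ] at h0 ⊢
          obtain ⟨i, hi, hi0⟩ := Finset.prod_eq_zero_iff.1 h0
          exact Finset.prod_eq_zero (Finset.range_subset_range.2 hc1 hi) hi0
        · right
          rw [hPs k hkd]
          rcases h with h | h
          · have : (d : ℚ) + 1 = k + 1 + c (k + 1) := by exact_mod_cast h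
            rw [show (d : ℚ) - k - c (k + 1) = 0 by linarith, zero_mul]
          · rw [h, mul_zero]
  have hrange : ∏ i ∈ Finset.range d, ((d : ℚ) - i - c (i + 1)) = P 0 := by
    rw [Finset.range_eq_Ico]
  rw [hrange]
  rcases main d 0 (zero_add d) with ⟨t, ht, h⟩ | ⟨h0, h | h⟩
  · rw [h, show d - c 0 = t by lia]
  -- Ending at height `-1` contradicts `c 0 ≤ d`.
  · lia
  · rw [h]
    exact (mul_eq_zero_of_right _ h0).symm

/-- A discrete intermediate value argument: the height `d - i - c i` goes from a negative value at
`i = 0` to `0` at `i = d` in steps of size at most one, so it takes the value `-1`. -/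
theorem exists_add_eq_succ {d : ℕ} {c : ℕ → ℕ} (hcd : c d = 0)
    (hc : ∀ k < d, c (k + 1) ≤ c k ∧ c k ≤ c (k + 1) + 2) (hb : d < c 0) :
    ∃ i ≤ d, i + c i = d + 1 := by
  have main : ∀ j k, k + j = d → d < k + c k → ∃ i ≤ d, i + c i = d + 1 := by
    intro j
    induction j with
    | zero => rintro k rfl h; lia
    | succ j ih =>
      intro k hk h
      by_cases he : k + c k = d + 1
      · exact ⟨k, by lia, he⟩
      · have := hc k (by lia)
        exact ih (k + 1) (by lia) (by lia)
  exact main d 0 (zero_add d) (by lia)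

/-! ### Ranks and counts in the dale rank set. -/

/-- `DaleRank d` inside `ℕ × Bool`. -/
def DaleRank.toProd (d : ℕ) : DaleRank d ↪ ℕ × Bool where
  toFun x := ((ofLex x).1, (ofLex x).2)
  inj' x y h := by
    obtain ⟨h1, h2⟩ := Prod.mk.inj h
    exact ofLex.injective (Prod.ext (Fin.ext h1) h2)

theorem numFstGE_map {d : ℕ} (B : Finset (DaleRank d)) (i : ℕ) :
    numFstGE (B.map (DaleRank.toProd d)) i = numRankGE B (i + 1) := by
  rw [numFstGE, Finset.filter_map, Finset.card_map, numRankGE]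
  congr 1
  ext x
  simp only [Finset.mem_filter, Function.comp_apply, DaleRank.rank, Nat.add_le_add_iff_right]
  rfl

theorem sum_powerset_range_product {d : ℕ} (f : Finset (ℕ × Bool) → ℚ) :
    ∑ B ∈ (Finset.range d ×ˢ (Finset.univ : Finset Bool)).powerset, f B =
      ∑ B : Finset (DaleRank d), f (B.map (DaleRank.toProd d)) := by
  have h : Finset.range d ×ˢ (Finset.univ : Finset Bool) =
      Finset.univ.map (DaleRank.toProd d) := by
    ext ⟨i, x⟩
    simp only [Finset.mem_product, Finset.mem_range, Finset.mem_univ, and_true,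
      Finset.mem_map, true_and]
    constructor
    · intro hi; exact ⟨toLex (⟨i, hi⟩, x), rfl⟩
    · rintro ⟨y, hy⟩
      rw [← (Prod.mk.inj hy).1]
      exact (ofLex y).1.2
  symm
  refine Finset.sum_bij (fun B _ => B.map (DaleRank.toProd d)) ?_ ?_ ?_ fun _ _ => rfl
  · intro B _
    rw [h, Finset.mem_powerset, Finset.map_subset_map]
    exact Finset.subset_univ _
  · intro B _ B' _ hBB
    exact Finset.map_injective _ hBB
  · intro A hA
    rw [h, Finset.mem_powerset, Finset.subset_map_iff] at hA
    obtain ⟨B, -, rfl⟩ := hA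
    exact ⟨B, Finset.mem_univ _, rfl⟩

theorem numRankGE_one {d : ℕ} (B : Finset (DaleRank d)) : numRankGE B 1 = B.card := by
  simp [numRankGE, DaleRank.rank]

theorem numRankGE_succ_card {d : ℕ} (B : Finset (DaleRank d)) : numRankGE B (d + 1) = 0 := by
  rw [numRankGE, Finset.card_eq_zero, Finset.filter_eq_empty_iff]
  intro x _
  have := (ofLex x).1.2
  simp only [DaleRank.rank]
  lia

theorem numRankGE_step {d : ℕ} (B : Finset (DaleRank d)) (k : ℕ) :
    numRankGE B (k + 2) ≤ numRankGE B (k + 1) ∧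
      numRankGE B (k + 1) ≤ numRankGE B (k + 2) + 2 := by
  rw [← numFstGE_map, ← numFstGE_map]
  generalize B.map (DaleRank.toProd d) = A
  constructor
  · exact Finset.card_le_card fun x => by simp only [Finset.mem_filter]; lia
  · have : A.filter (fun x => k ≤ x.1) ⊆
        A.filter (fun x => k + 1 ≤ x.1) ∪ {(k, false), (k, true)} := by
      rintro ⟨i, x⟩
      cases x <;> simp <;> lia
    refine (Finset.card_le_card this).trans ((Finset.card_union_le _ _).trans ?_)
    exact Nat.add_le_add_left Finset.card_le_two _

theorem DaleRank.rank_mono {d : ℕ} {x y : DaleRank d} (h : x ≤ y) : x.rank ≤ y.rank := by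
  rcases Prod.Lex.le_iff.1 h with h | h
  · exact Nat.succ_le_succ (Fin.lt_def.1 h).le
  · exact (congrArg (fun a : Fin d => (a : ℕ) + 1) h.1).le

/-- The index `B.card - i` selects the `(i + 1)`-th largest element. Rank is monotone, so the
elements of rank at least `q` form a final segment of `B`. -/
theorem le_nthRank_iff {d : ℕ} (B : Finset (DaleRank d)) {i q : ℕ} (hi : i < B.card) :
    q ≤ nthRank B (B.card - i) ↔ i < numRankGE B q := by
  set e := B.orderEmbOfFin rfl with he
  have hcard : numRankGE B q = (Finset.univ.filter fun t => q ≤ (e t).rank).card := by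
    have : B.filter (fun x => q ≤ x.rank) =
        (Finset.univ.filter fun t => q ≤ (e t).rank).map e.toEmbedding := by
      conv_lhs => rw [← Finset.map_orderEmbOfFin_univ B rfl, Finset.filter_map]
      rfl
    rw [numRankGE, this, Finset.card_map]
  have hlt : B.card - i - 1 < B.card := by lia
  have hnth : nthRank B (B.card - i) = (e ⟨B.card - i - 1, hlt⟩).rank := by
    rw [nthRank, dif_pos (by lia)]
  rw [hnth, hcard]
  constructor
  · intro h
    have hsub : Finset.Ici (⟨B.card - i - 1, hlt⟩ : Fin B.card) ⊆
        Finset.univ.filter fun t => q ≤ (e t).rank := by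
      intro t ht
      rw [Finset.mem_filter]
      exact ⟨Finset.mem_univ _, h.trans (DaleRank.rank_mono (e.monotone (Finset.mem_Ici.1 ht)))⟩
    have := Finset.card_le_card hsub
    rw [Fin.card_Ici] at this
    simp only at this
    lia
  · intro h
    by_contra! hq
    have hsub : (Finset.univ.filter fun t => q ≤ (e t).rank) ⊆
        Finset.Ioi (⟨B.card - i - 1, hlt⟩ : Fin B.card) := by
      intro t ht
      rw [Finset.mem_Ioi]
      by_contra! hle
      exact (((Finset.mem_filter.1 ht).2.trans
        (DaleRank.rank_mono (e.monotone hle))).trans_lt hq).false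
    have := Finset.card_le_card hsub
    rw [Fin.card_Ioi] at this
    simp only at this
    lia

theorem nthRank_eq {d : ℕ} (B : Finset (DaleRank d)) {i k : ℕ} (h1 : numRankGE B (k + 2) ≤ i)
    (h2 : i < numRankGE B (k + 1)) : nthRank B (B.card - i) = k + 1 := by
  have hi : i < B.card := h2.trans_le (Finset.card_filter_le _ _)
  have h3 := (le_nthRank_iff B hi).2 h2
  have h4 := (le_nthRank_iff B (q := k + 2) hi).not.2 h1.not_gt
  lia

theorem gapTerm_map_of_card_le {d : ℕ} (g : ℕ → ℕ) {B : Finset (DaleRank d)} (hB : B.card ≤ d) :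
    gapTerm g d (B.map (DaleRank.toProd d)) 1 =
      2 ^ (∑ i ∈ Finset.range (d + 1), g i) / 2 ^ d *
        ((-1 : ℚ) ^ B.card * ((d - B.card).factorial : ℚ) *
          (∏ i ∈ Finset.range B.card, ((d : ℚ) + 1 - i - nthRank B (B.card - i))) *
          ∏ i ∈ Finset.range (d + 1), ((d : ℚ) + 1 - i - numRankGE B (i + 1)) ^ g i) := by
  have h := prod_height_eq (c := fun i => numRankGE B (i + 1))
    (r := fun i => nthRank B (B.card - i)) (numRankGE_succ_card B)
    (fun k _ => numRankGE_step B k) (fun k _ i => nthRank_eq B)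
    (by simpa [numRankGE_one] using hB)
  simp only [zero_add, numRankGE_one] at h
  simp only [gapTerm, numFstGE_map, Finset.card_map, mul_pow, Finset.prod_mul_distrib,
    Finset.prod_div_distrib, Finset.prod_const, Finset.card_range, Finset.prod_pow_eq_pow_sum]
  have h1 : ∏ i ∈ Finset.range d, (1 + (d : ℚ) - (i + 1) - numRankGE B (i + 1 + 1)) =
      ∏ i ∈ Finset.range d, ((d : ℚ) - i - numRankGE B (i + 1 + 1)) :=
    Finset.prod_congr rfl fun i _ => by ring
  rw [h1, h, add_comm (1 : ℚ)]
  ring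

theorem gapTerm_map_of_lt_card {d : ℕ} {g : ℕ → ℕ} (hg : 1 ≤ g 0) {B : Finset (DaleRank d)}
    (hB : d < B.card) : gapTerm g d (B.map (DaleRank.toProd d)) 1 = 0 := by
  obtain ⟨i, hid, hi⟩ := exists_add_eq_succ (c := fun i => numRankGE B (i + 1))
    (numRankGE_succ_card B) (fun k _ => numRankGE_step B k) (by simpa [numRankGE_one] using hB)
  have hi' : (i : ℚ) + numRankGE B (i + 1) = d + 1 := by exact_mod_cast hi
  simp only [gapTerm, numFstGE_map]
  cases i with
  | zero =>
    -- Height `-1` at `i = 0` is seen only by the gap factor, whose exponent is positive by `hg`; at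
    -- a later index it annihilates a factor of the first product.
    rw [Finset.prod_eq_zero (s := Finset.range (d + 1)) (i := 0) (by simp), mul_zero]
    rw [show 1 + (d : ℚ) - (0 : ℕ) - numRankGE B (0 + 1) = 0 by linarith, mul_zero,
      zero_pow (by lia)]
  | succ i =>
    rw [Finset.prod_eq_zero (s := Finset.range d) (i := i) (by simpa using hid), mul_zero,
      zero_mul]
    push_cast at hi'
    rw [show 1 + (d : ℚ) - (i + 1) - numRankGE B (i + 1 + 1) = 0 by linarith, zero_div]

end Pinnacle

theorem mainTheorem1 (n : ℕ) (hn : 1 ≤ n) (S : Finset ℕ)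
    (hS : Pinnacle.IsAdmissible S) (hSn : ∀ s ∈ S, s ≤ n)
    (d : ℕ) (hd : S.card = d) :
    (Pinnacle.pinnacleCount S n : ℚ) =
      (2 : ℚ) ^ ((n : ℤ) - 2 * (d : ℤ) - 1) *
        ∑ B ∈ (Finset.univ : Finset (Finset (Pinnacle.DaleRank d))).filter
            (fun B => B.card ≤ d),
          (-1 : ℚ) ^ B.card * (Nat.factorial (d - B.card) : ℚ) *
            (∏ i ∈ Finset.range B.card,
              ((d : ℚ) + 1 - (i : ℚ) - (Pinnacle.nthRank B (B.card - i) : ℚ))) *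
            (∏ i ∈ Finset.range (d + 1),
              ((d : ℚ) + 1 - (i : ℚ) - (Pinnacle.numRankGE B (i + 1) : ℚ)) ^
                Pinnacle.gap n S i) := by
  subst hd
  have hS' : S ⊆ Finset.Icc 1 n := fun s hs =>
    Finset.mem_Icc.2 ⟨by have := hS.two_le hs; lia, hSn s hs⟩
  rw [Pinnacle.pinnacleCount_eq_gapCount hn hS', Pinnacle.gapCount_eq_sum,
    Pinnacle.sum_powerset_range_product,
    ← Finset.sum_filter_of_ne (p := fun B : Finset (Pinnacle.DaleRank S.card) =>
      B.card ≤ S.card) fun B _ hB => by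
        by_contra! h
        exact hB (Pinnacle.gapTerm_map_of_lt_card (hS.one_le_gap_zero hn) h),
    Finset.sum_congr rfl fun B hB =>
      Pinnacle.gapTerm_map_of_card_le (Pinnacle.gap n S) (Finset.mem_filter.1 hB).2,
    ← Finset.mul_sum, mul_div_right_comm]
  congr 1
  have hsum := Pinnacle.sum_gap hS'
  -- The gaps sum to `n - d`; the `d` factors `m / 2` and the final halving supply the remaining `-d
  -- - 1`.
  rw [show (n : ℤ) - 2 * S.card - 1 =
      (∑ i ∈ Finset.range (S.card + 1), Pinnacle.gap n S i : ℕ) - S.card - 1 by lia,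
    zpow_sub₀ two_ne_zero, zpow_sub₀ two_ne_zero, zpow_natCast, zpow_natCast, zpow_one]
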